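/- Let $\ell\ge 1$. For $\mathbf n=(n_0,\dots,n_{\ell-1})\in\mathbb N^\ell$ put $|\mathbf n|=\sum_c n_c$, and let the support of $\mathbf n$ be $\{c : n_c\neq 0\}$. A vector composition is a finite (possibly empty) sequence $\mathbf I=(\mathbf i_1,\dots,\mathbf i_m)$ of nonzero columns $\mathbf i_r\in\mathbb N^\ell$; write $\operatorname{len}(\mathbf I)=m$, $\Sigma\mathbf I=\mathbf i_1+\cdots+\mathbf i_m$ and $|\mathbf I|=|\Sigma\mathbf I|$. Write $\mathbf I\preccurlyeq\mathbf J$ if $\mathbf J$ is a concatenation $\mathbf J_1\cdots\mathbf J_m$ of vector compositions with $\Sigma\mathbf J_r=\mathbf i_r$ such that in each $\mathbf J_r$ every element of the support of a column is at most every element of the support of every column further to the right. A coordinate vector composition is a (possibly empty) sequence of coordinate vectors $\mathbf e_c$. Let $\mathrm{QSym}^{(\ell)}$ be the $\mathbb N^\ell$-graded Hopf algebra over $\mathbb Q$ of quasisymmetric functions of level $\ell$ in the variables $x_j^{(c)}$ ($j\ge1$, $0\le c<\ell$), with monomial basis $M_{\mathbf I}=\sum_{j_1<\cdots<j_m}\mathbf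 x_{j_1}^{\mathbf i_1}\cdots\mathbf x_{j_m}^{\mathbf i_m}$, where $\mathbf x_j^{\mathbf n}=\prod_c (x_j^{(c)})^{n_c}$, coproduct $\Delta(M_{\mathbf I})=\sum_{\mathbf I=\mathbf J\mathbf K}M_{\mathbf J}\otimes M_{\mathbf K}$ (sum over deconcatenations), antipode $S$, and quasi-ribbon functions $F_{\mathbf I}=\sum_{\mathbf I\preccurlyeq\mathbf J}M_{\mathbf J}$. Let $\zeta_Q$ be the linear functional with $\zeta_Q(M_{\mathbf I})=1$ if $\operatorname{len}(\mathbf I)\le1$ and $0$ otherwise. For $\mathbf k\in(\mathbb N\cup\{\infty\})^\ell$ let $\zeta_Q^{\mathbf k}$ be the linear functional that equals $(-1)^{|\mathbf n|}\zeta_Q$ on the component of multidegree $\mathbf n$ if $\mathbf n\le\mathbf k$ (componentwise), and equals $\zeta_Q$ on it otherwise. Let $\nu_Q^{\mathbf k}=(\zeta_Q^{\mathbf k}\circ S)\,\zeta_Q$, a convolution product of linear functionals. Then for every vector composition $\mathbf I=(\mathbf i_1,\dots,\mathbf i_m)$, $$\nu_Q^{\mathbf k}(M_{\mathbf I})=\begin{cases}1&\text{if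 }\mathbf I=(\,),\\ 2(-1)^{\operatorname{len}(\mathbf I)+|\mathbf I|}&\text{if }|\mathbf i_m|\text{ is odd and }\Sigma\mathbf I\le\mathbf k,\\ 2(-1)^{\operatorname{len}(\mathbf I)}&\text{if }|\mathbf I|-|\mathbf i_m|\text{ is odd, }\Sigma\mathbf I-\mathbf i_m\le\mathbf k\text{ and }\Sigma\mathbf I\not\le\mathbf k,\\ 0&\text{otherwise.}\end{cases}$$ Moreover $\nu_Q^{\mathbf k}(F_{\mathbf I})=1$ if $\mathbf I=(\,)$; $\nu_Q^{\mathbf k}(F_{\mathbf I})=2$ if $\mathbf I=(\mathbf E,\mathbf i)$, where $\mathbf E$ is a coordinate vector composition, $\mathbf i$ is a column, and one of the following holds: (1) $\Sigma\mathbf I\le\mathbf k$; (2) $|\mathbf E|$ is odd and $\Sigma\mathbf E\le\mathbf k$; (3) $|\mathbf E|$ is even, $|\mathbf i|>1$ and $\Sigma\mathbf E+\mathbf e\le\mathbf k$, where $\mathbf e$ is the unique coordinate vector such that $(\mathbf e,\mathbf i-\mathbf e)$ is a vector composition with $(\mathbf i)\preccurlyeq(\mathbf e,\mathbf i-\mathbf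 e)$; and $\nu_Q^{\mathbf k}(F_{\mathbf I})=0$ otherwise. (Such an $\mathbf e$ exists and is unique whenever $|\mathbf i|>1$.) -/

import Mathlib

namespace LevelQSym

open scoped TensorProduct

/-! ### `ℓ`-partite numbers and vector compositions -/

/-- A column of a vector composition: a nonzero `ℓ`-partite number. -/
abbrev Col (ℓ : ℕ) : Type := {v : Fin ℓ → ℕ // v ≠ 0}

/-- Vector compositions of level `ℓ`: finite sequences of nonzero columns
(concatenation is `++`, the empty composition is `[]`, the length is `List.length`). -/
abbrev VComp (ℓ : ℕ) : Type := List (Col ℓ)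

/-- The weight `|n|` of an `ℓ`-partite number. -/
def wt {ℓ : ℕ} (v : Fin ℓ → ℕ) : ℕ := ∑ c, v c

/-- `ΣI`, the sum of the columns of `I`. -/
def colSum {ℓ : ℕ} (I : VComp ℓ) : Fin ℓ → ℕ := (I.map Subtype.val).sum

/-- `|I|`, the sum of the weights of the columns of `I`. -/
def weight {ℓ : ℕ} (I : VComp ℓ) : ℕ := (I.map fun v => wt v.1).sum

/-- The componentwise order between `ℓ`-partite numbers and extended `ℓ`-partite numbers. -/
def LeExt {ℓ : ℕ} (n : Fin ℓ → ℕ) (k : Fin ℓ → ℕ∞) : Prop := ∀ c, (n c : ℕ∞) ≤ k c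

/-- A coordinate vector `e_c`. -/
def IsCoord {ℓ : ℕ} (v : Col ℓ) : Prop := ∃ c : Fin ℓ, v.1 = Pi.single c 1

/-- `I ≼ J`: `J` is a concatenation of vector compositions `J_1, …, J_m`, where `J_r` sums up to the
`r`-th column of `I`, and in each `J_r` every element of the support of a column is at most every
element of the support of every column further to the right. -/
def Refines {ℓ : ℕ} (I J : VComp ℓ) : Prop :=
  ∃ L : List (VComp ℓ), J = L.flatten ∧
    List.Forall₂ (fun (K : VComp ℓ) (i : Col ℓ) => colSum K = i.1 ∧
      K.Pairwise (fun a b => ∀ p q : Fin ℓ, a.1 p ≠ 0 → b.1 q ≠ 0 → p ≤ q)) L I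

/-! ### Power series in the colored variables and quasisymmetric functions

The variable with index `(j, c) : ℕ × Fin ℓ` is the `j`-th variable of color `c`. -/

/-- The exponent of the monomial `x_{j_1}^{i_1} ⋯ x_{j_m}^{i_m}`, for `I = (i_1, …, i_m)`. -/
noncomputable def expo {ℓ : ℕ} (I : VComp ℓ) (j : Fin I.length → ℕ) : (ℕ × Fin ℓ) →₀ ℕ :=
  ∑ r, ∑ c, Finsupp.single (j r, c) ((I.get r).1 c)

/-- Quasisymmetric functions of level `ℓ`: power series of bounded degree such that the coefficients
of `x_{j_1}^{i_1} ⋯ x_{j_m}^{i_m}` and of the corresponding monomial in the first `m` groups of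
variables agree, for all vector compositions and all `j_1 < ⋯ < j_m`. -/
def IsQSym {ℓ : ℕ} (f : MvPowerSeries (ℕ × Fin ℓ) ℚ) : Prop :=
  (∃ N : ℕ, ∀ d, MvPowerSeries.coeff d f ≠ 0 → d.degree ≤ N) ∧
  ∀ (I : VComp ℓ) (j : Fin I.length → ℕ), StrictMono j →
    MvPowerSeries.coeff (expo I j) f = MvPowerSeries.coeff (expo I fun r => (r : ℕ)) f

/-! #### Monomials and vector compositions -/

theorem expo_apply {ℓ : ℕ} (I : VComp ℓ) {j : Fin I.length → ℕ} (hj : StrictMono j)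
    (r : Fin I.length) (c : Fin ℓ) : expo I j (j r, c) = (I.get r).1 c := by
  classical
  unfold expo
  simp only [Finsupp.finsetSum_apply, Finsupp.single_apply, Prod.mk.injEq, hj.injective.eq_iff]
  rw [Finset.sum_eq_single r]
  · simp
  · intro b _ hb
    simp [hb]
  · simp

theorem expo_apply_of_notMem {ℓ : ℕ} (I : VComp ℓ) {j : Fin I.length → ℕ}
    (n : ℕ) (hn : n ∉ Set.range j) (c : Fin ℓ) : expo I j (n, c) = 0 := by
  classical
  unfold expo
  simp only [Finsupp.finsetSum_apply, Finsupp.single_apply, Prod.mk.injEq]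
  refine Finset.sum_eq_zero fun r _ => Finset.sum_eq_zero fun c' _ => ?_
  rw [if_neg]
  rintro ⟨h, -⟩
  exact hn ⟨r, h⟩

/-- The indices of the groups of variables that occur in a monomial. -/
def rows {ℓ : ℕ} (d : (ℕ × Fin ℓ) →₀ ℕ) : Finset ℕ := d.support.image Prod.fst

theorem mem_rows {ℓ : ℕ} (d : (ℕ × Fin ℓ) →₀ ℕ) (n : ℕ) : n ∈ rows d ↔ ∃ c, d (n, c) ≠ 0 := by
  simp [rows]

theorem rows_expo {ℓ : ℕ} (I : VComp ℓ) {j : Fin I.length → ℕ} (hj : StrictMono j) :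
    rows (expo I j) = Finset.univ.image j := by
  ext n
  simp only [mem_rows, Finset.mem_image, Finset.mem_univ, true_and]
  constructor
  · rintro ⟨c, hc⟩
    by_contra h
    exact hc (expo_apply_of_notMem I n (fun ⟨r, hr⟩ => h ⟨r, hr⟩) c)
  · rintro ⟨r, rfl⟩
    obtain ⟨c, hc⟩ := Function.ne_iff.mp (I.get r).2
    exact ⟨c, by rw [expo_apply I hj]; exact hc⟩

/-- Every monomial arises from a vector composition. -/
theorem exists_expo {ℓ : ℕ} (d : (ℕ × Fin ℓ) →₀ ℕ) :
    ∃ (I : VComp ℓ) (j : Fin I.length → ℕ), StrictMono j ∧ expo I j = d := by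
  classical
  let J : Fin (rows d).card → Col ℓ := fun r =>
    ⟨fun c => d ((rows d).orderEmbOfFin rfl r, c), by
      obtain ⟨c, hc⟩ := (mem_rows d _).1 ((rows d).orderEmbOfFin_mem rfl r)
      exact Function.ne_iff.mpr ⟨c, hc⟩⟩
  have hlen : (List.ofFn J).length = (rows d).card := List.length_ofFn
  let j : Fin (List.ofFn J).length → ℕ := fun r => (rows d).orderEmbOfFin rfl (Fin.cast hlen r)
  have hj : StrictMono j := fun a b hab => by
    simp only [j, OrderEmbedding.lt_iff_lt]
    exact hab
  refine ⟨List.ofFn J, j, hj, ?_⟩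
  ext ⟨n, c⟩
  by_cases hn : n ∈ Set.range j
  · obtain ⟨r, rfl⟩ := hn
    rw [expo_apply _ hj]
    simp [J, j, Fin.cast]
  · rw [expo_apply_of_notMem _ n hn]
    by_contra h
    have : n ∈ rows d := (mem_rows d n).2 ⟨c, fun h' => h h'.symm⟩
    have h2 : n ∈ Set.range ((rows d).orderEmbOfFin rfl) := by
      rw [Finset.range_orderEmbOfFin]; exact this
    obtain ⟨s, hs⟩ := h2
    exact hn ⟨Fin.cast hlen.symm s, by simp [j, hs]⟩

/-- The vector composition of a monomial is unique. -/
theorem expo_inj {ℓ : ℕ} {I I' : VComp ℓ} {j : Fin I.length → ℕ} {j' : Fin I'.length → ℕ}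
    (hj : StrictMono j) (hj' : StrictMono j') (h : expo I j = expo I' j') : I = I' := by
  classical
  have hr := rows_expo I hj
  rw [h, rows_expo I' hj'] at hr
  have hlen : I.length = I'.length := by
    have := congrArg Finset.card hr
    rw [Finset.card_image_of_injective _ hj.injective,
      Finset.card_image_of_injective _ hj'.injective] at this
    simpa using this.symm
  have hc : (Finset.univ.image j).card = I.length := by
    rw [Finset.card_image_of_injective _ hj.injective]; simp
  have e1 : j = (Finset.univ.image j).orderEmbOfFin hc :=
    Finset.orderEmbOfFin_unique hc (fun x => by simp) hj
  have e2 : (fun r : Fin I.length => j' (Fin.cast hlen r)) =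
      (Finset.univ.image j).orderEmbOfFin hc :=
    Finset.orderEmbOfFin_unique hc (fun x => by rw [← hr]; simp)
      (fun a b hab => hj' (by exact hab))
  have e3 : ∀ r, j r = j' (Fin.cast hlen r) := fun r => by
    rw [congrFun e1 r, ← congrFun e2 r]
  refine List.ext_getElem hlen fun n h1 h2 => Subtype.ext (funext fun c => ?_)
  have a1 := expo_apply I hj ⟨n, h1⟩ c
  have a2 := expo_apply I' hj' ⟨n, h2⟩ c
  have a3 := e3 ⟨n, h1⟩
  simp only [Fin.cast_mk] at a3
  rw [h, a3, a2] at a1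
  simpa using a1.symm

/-- Renumbering the groups of variables. -/
def renum {ℓ : ℕ} (φ : ℕ ↪o ℕ) : (ℕ × Fin ℓ) ↪ (ℕ × Fin ℓ) :=
  φ.toEmbedding.prodMap (Function.Embedding.refl _)

theorem embDomain_expo {ℓ : ℕ} (φ : ℕ ↪o ℕ) (I : VComp ℓ) (j : Fin I.length → ℕ) :
    (expo I j).embDomain (renum φ) = expo I fun r => φ (j r) := by
  unfold expo
  simp only [Finsupp.embDomain_eq_mapDomain, Finsupp.mapDomain_finsetSum,
    Finsupp.mapDomain_single]
  rfl

theorem strictMono_val (n : ℕ) : StrictMono fun r : Fin n => (r : ℕ) := fun _ _ h => h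

theorem exists_extend {m : ℕ} (j : Fin m → ℕ) (hj : StrictMono j) :
    ∃ φ : ℕ ↪o ℕ, ∀ r : Fin m, φ r = j r := by
  let g : ℕ → ℕ := fun n => if h : n < m then j ⟨n, h⟩ else (∑ r, j r) + n + 1
  refine ⟨OrderEmbedding.ofStrictMono g (strictMono_nat_of_lt_succ fun n => ?_), fun r => ?_⟩
  · by_cases h1 : n + 1 < m
    · have h0 : n < m := by omega
      simp only [g, h1, h0, dif_pos]
      exact hj (by simp)
    · by_cases h0 : n < m
      · simp only [g, h1, h0, dif_pos, dif_neg, not_false_eq_true]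
        have := Finset.single_le_sum (f := j) (fun _ _ => Nat.zero_le _) (Finset.mem_univ ⟨n, h0⟩)
        omega
      · simp only [g, h1, h0, dif_neg, not_false_eq_true]
        omega
  · simp [g]

/-- The coefficients of a quasisymmetric function are invariant under renumbering. -/
theorem IsQSym.coeff_embDomain {ℓ : ℕ} {f : MvPowerSeries (ℕ × Fin ℓ) ℚ} (hf : IsQSym f)
    (φ : ℕ ↪o ℕ) (d : (ℕ × Fin ℓ) →₀ ℕ) :
    MvPowerSeries.coeff (d.embDomain (renum φ)) f = MvPowerSeries.coeff d f := by
  obtain ⟨I, j, hj, rfl⟩ := exists_expo d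
  rw [embDomain_expo, hf.2 I j hj]
  exact hf.2 I (fun r => φ (j r)) (φ.strictMono.comp hj)

theorem IsQSym.mul {ℓ : ℕ} {f g : MvPowerSeries (ℕ × Fin ℓ) ℚ} (hf : IsQSym f) (hg : IsQSym g) :
    IsQSym (f * g) := by
  classical
  obtain ⟨N, hN⟩ := hf.1
  obtain ⟨N', hN'⟩ := hg.1
  refine ⟨⟨N + N', fun d hd => ?_⟩, fun I j hj => ?_⟩
  · rw [MvPowerSeries.coeff_mul] at hd
    obtain ⟨p, hp, hne⟩ := Finset.exists_ne_zero_of_sum_ne_zero hd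
    rw [Finset.HasAntidiagonal.mem_antidiagonal] at hp
    rw [← hp, map_add]
    exact add_le_add (hN _ (left_ne_zero_of_mul hne)) (hN' _ (right_ne_zero_of_mul hne))
  · obtain ⟨φ, hφ⟩ := exists_extend j hj
    have : expo I j = (expo I fun r => (r : ℕ)).embDomain (renum φ) := by
      rw [embDomain_expo]; exact congrArg _ (funext fun r => (hφ r).symm)
    rw [this, MvPowerSeries.coeff_mul, MvPowerSeries.coeff_mul,
      ← Finsupp.image_prodMap_embDomain_antidiagonal, Finset.sum_image]
    · exact Finset.sum_congr rfl fun p _ => by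
        simp only [Prod.map, hf.coeff_embDomain, hg.coeff_embDomain]
    · rintro ⟨a, b⟩ _ ⟨a', b'⟩ _ h
      simp only [Prod.map, Prod.mk.injEq, Finsupp.embDomain_inj] at h
      exact Prod.ext h.1 h.2

theorem expo_eq_zero {ℓ : ℕ} {I : VComp ℓ} {j : Fin I.length → ℕ} (hj : StrictMono j)
    (h : expo I j = 0) : I = [] :=
  expo_inj (I' := []) (j' := fun r => (r : ℕ)) hj (strictMono_val _) (by rw [h]; simp [expo])

theorem isQSym_algebraMap {ℓ : ℕ} (r : ℚ) :
    IsQSym (algebraMap ℚ (MvPowerSeries (ℕ × Fin ℓ) ℚ) r) := by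
  classical
  simp only [MvPowerSeries.algebraMap_apply, Algebra.algebraMap_self, RingHom.id_apply]
  refine ⟨⟨0, fun d hd => ?_⟩, fun I j hj => ?_⟩
  · rw [MvPowerSeries.coeff_C] at hd
    have : d = 0 := by by_contra h; simp [h] at hd
    simp [this]
  · rw [MvPowerSeries.coeff_C, MvPowerSeries.coeff_C]
    have : expo I j = 0 ↔ (expo I fun r => (r : ℕ)) = 0 := by
      constructor
      · intro h
        obtain rfl := expo_eq_zero hj h
        simp [expo]
      · intro h
        obtain rfl := expo_eq_zero (strictMono_val _) h
        simp [expo]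
    simp only [this]

/-- The algebra of quasisymmetric functions of level `ℓ`. -/
def QSym (ℓ : ℕ) : Subalgebra ℚ (MvPowerSeries (ℕ × Fin ℓ) ℚ) where
  carrier := {f | IsQSym f}
  mul_mem' hf hg := IsQSym.mul hf hg
  add_mem' := by
    rintro f g ⟨⟨N, hN⟩, hf⟩ ⟨⟨N', hN'⟩, hg⟩
    refine ⟨⟨max N N', fun d hd => ?_⟩, fun I j hj => ?_⟩
    · rw [map_add] at hd
      by_cases h : MvPowerSeries.coeff d f = 0
      · rw [h, zero_add] at hd
        exact (hN' d hd).trans (le_max_right _ _)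
      · exact (hN d h).trans (le_max_left _ _)
    · rw [map_add, map_add, hf I j hj, hg I j hj]
  algebraMap_mem' := isQSym_algebraMap

/-! ### The monomial basis -/

theorem degree_expo {ℓ : ℕ} (I : VComp ℓ) (j : Fin I.length → ℕ) :
    (expo I j).degree = weight I := by
  unfold expo weight wt
  simp only [map_sum, Finsupp.degree_single]
  rw [← List.sum_ofFn]
  congr 1
  refine List.ext_getElem (by simp) fun n h1 h2 => by simp

open Classical in
/-- The power series `∑_{j_1 < ⋯ < j_m} x_{j_1}^{i_1} ⋯ x_{j_m}^{i_m}`. (As the columns are nonzero,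
different `j_1 < ⋯ < j_m` give different monomials.) -/
noncomputable def monomialSeries {ℓ : ℕ} (I : VComp ℓ) : MvPowerSeries (ℕ × Fin ℓ) ℚ :=
  fun d => if ∃ j : Fin I.length → ℕ, StrictMono j ∧ expo I j = d then 1 else 0

open Classical in
theorem coeff_monomialSeries {ℓ : ℕ} (I J : VComp ℓ) {j : Fin J.length → ℕ} (hj : StrictMono j) :
    MvPowerSeries.coeff (expo J j) (monomialSeries I) = if I = J then 1 else 0 := by
  change (if ∃ j' : Fin I.length → ℕ, StrictMono j' ∧ expo I j' = expo J j then (1 : ℚ) else 0) = _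
  congr 1
  refine propext ⟨fun ⟨j', h1, h2⟩ => expo_inj h1 hj h2, ?_⟩
  rintro rfl
  exact ⟨j, hj, rfl⟩

theorem isQSym_monomialSeries {ℓ : ℕ} (I : VComp ℓ) : IsQSym (monomialSeries I) := by
  classical
  refine ⟨⟨weight I, fun d hd => ?_⟩, fun J j hj => ?_⟩
  · obtain ⟨J, j, hj, rfl⟩ := exists_expo d
    rw [coeff_monomialSeries I J hj] at hd
    have : I = J := by by_contra h; simp [h] at hd
    rw [degree_expo, this]
  · rw [coeff_monomialSeries I J hj, coeff_monomialSeries I J (strictMono_val _)]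

/-- There are finitely many vector compositions of bounded weight. -/
theorem finite_weight_le {ℓ : ℕ} (N : ℕ) : {I : VComp ℓ | weight I ≤ N}.Finite := by
  classical
  let D : (ℕ × Fin ℓ) →₀ ℕ :=
    ∑ p ∈ Finset.range N ×ˢ (Finset.univ : Finset (Fin ℓ)), Finsupp.single p N
  refine Set.Finite.of_finite_image (f := fun I : VComp ℓ => expo I fun r => (r : ℕ))
    ((Set.finite_Iic D).subset ?_)
    (fun I _ J _ h => expo_inj (strictMono_val _) (strictMono_val _) h)
  rintro _ ⟨I, hI, rfl⟩
  rw [Set.mem_Iic, Finsupp.le_def]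
  rintro ⟨n, c⟩
  by_cases hz : expo I (fun r => (r : ℕ)) (n, c) = 0
  · rw [hz]; exact Nat.zero_le _
  have hn : n < I.length := by
    by_contra h
    refine hz (expo_apply_of_notMem I n ?_ c)
    rintro ⟨r, rfl⟩
    exact h r.2
  have hlen : ∀ J : VComp ℓ, J.length ≤ weight J := by
    intro J
    induction J with
    | nil => simp
    | cons v J ih =>
      have : 0 < wt v.1 := by
        obtain ⟨c, hc⟩ := Function.ne_iff.mp v.2
        exact lt_of_lt_of_le (Nat.pos_of_ne_zero hc)
          (Finset.single_le_sum (f := v.1) (fun _ _ => Nat.zero_le _) (Finset.mem_univ c))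
      simp only [weight, List.map_cons, List.sum_cons, List.length_cons] at ih ⊢
      omega
  have hnN : n < N := lt_of_lt_of_le hn ((hlen I).trans hI)
  have hD : D (n, c) = N := by
    simp only [D, Finsupp.finsetSum_apply, Finsupp.single_apply]
    rw [Finset.sum_ite_eq' (Finset.range N ×ˢ Finset.univ) (n, c) (fun _ => N)]
    simp [hnN]
  rw [hD]
  exact (Finsupp.le_degree (n, c) _).trans ((degree_expo I _).le.trans hI)

/-- The coordinates of a quasisymmetric function. -/
noncomputable def coordMap (ℓ : ℕ) : QSym ℓ →ₗ[ℚ] (VComp ℓ →₀ ℚ) where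
  toFun f := Finsupp.ofSupportFinite
    (fun I => MvPowerSeries.coeff (expo I fun r => (r : ℕ)) f.1) (by
      obtain ⟨N, hN⟩ := f.2.1
      refine (finite_weight_le N).subset fun I hI => ?_
      have := hN _ hI
      rwa [degree_expo] at this)
  map_add' f g := Finsupp.ext fun I =>
    (MvPowerSeries.coeff (expo I fun r => (r : ℕ))).map_add f.1 g.1
  map_smul' a f := Finsupp.ext fun I =>
    (MvPowerSeries.coeff (expo I fun r => (r : ℕ))).map_smul a f.1

theorem coordMap_apply {ℓ : ℕ} (f : QSym ℓ) (I : VComp ℓ) :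
    coordMap ℓ f I = MvPowerSeries.coeff (expo I fun r => (r : ℕ)) f.1 := rfl

theorem coordMap_monomial {ℓ : ℕ} (I : VComp ℓ) :
    coordMap ℓ ⟨monomialSeries I, isQSym_monomialSeries I⟩ = Finsupp.single I 1 := by
  classical
  ext J
  rw [coordMap_apply, coeff_monomialSeries I J (strictMono_val _), Finsupp.single_apply]

theorem coordMap_bijective (ℓ : ℕ) : Function.Bijective (coordMap ℓ) := by
  constructor
  · rw [injective_iff_map_eq_zero]
    intro f hf
    ext d
    obtain ⟨I, j, hj, rfl⟩ := exists_expo d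
    rw [f.2.2 I j hj, ← coordMap_apply, hf]
    simp
  · rw [← LinearMap.range_eq_top, eq_top_iff]
    rintro x -
    induction x using Finsupp.induction_linear with
    | zero => exact Submodule.zero_mem _
    | add f g hf hg => exact Submodule.add_mem _ hf hg
    | single I a =>
      have : Finsupp.single I a = a • Finsupp.single I (1 : ℚ) := by simp
      rw [this, ← coordMap_monomial]
      exact Submodule.smul_mem _ _ ⟨_, rfl⟩

/-- The basis of monomial quasisymmetric functions `M_I`. -/
noncomputable def M (ℓ : ℕ) : Module.Basis (VComp ℓ) ℚ (QSym ℓ) :=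
  Module.Basis.ofRepr (LinearEquiv.ofBijective (coordMap ℓ) (coordMap_bijective ℓ))

/-- `M_I` is the power series `∑_{j_1 < ⋯ < j_m} x_{j_1}^{i_1} ⋯ x_{j_m}^{i_m}`. -/
theorem coe_M {ℓ : ℕ} (I : VComp ℓ) : (M ℓ I).1 = monomialSeries I := by
  have : M ℓ I = ⟨monomialSeries I, isQSym_monomialSeries I⟩ := by
    apply (coordMap_bijective ℓ).1
    rw [coordMap_monomial]
    exact (M ℓ).repr_self I
  rw [this]

theorem M_nil (ℓ : ℕ) : M ℓ [] = 1 := by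
  classical
  apply Subtype.ext
  rw [coe_M]
  ext d
  obtain ⟨I, j, hj, rfl⟩ := exists_expo d
  rw [coeff_monomialSeries [] I hj, OneMemClass.coe_one, MvPowerSeries.coeff_one]
  congr 1
  refine propext ⟨?_, fun h => (expo_eq_zero hj h).symm⟩
  rintro rfl
  simp [expo]

/-! ### The quasi-ribbon functions -/

theorem weight_eq_wt_colSum {ℓ : ℕ} (I : VComp ℓ) : weight I = wt (colSum I) := by
  induction I with
  | nil => simp [weight, wt, colSum]
  | cons v I ih =>
    simp only [weight, colSum, wt, List.map_cons, List.sum_cons, Pi.add_apply,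
      Finset.sum_add_distrib] at ih ⊢
    rw [ih]

theorem Refines.colSum_eq {ℓ : ℕ} {I J : VComp ℓ} (h : Refines I J) : colSum J = colSum I := by
  obtain ⟨L, rfl, hL⟩ := h
  induction hL with
  | nil => rfl
  | cons h1 _ ih =>
    simp only [colSum, List.flatten_cons, List.map_append, List.sum_append, List.map_cons,
      List.sum_cons] at h1 ih ⊢
    rw [h1.1, ih]

theorem finite_refines {ℓ : ℕ} (I : VComp ℓ) : {J : VComp ℓ | Refines I J}.Finite :=
  (finite_weight_le (weight I)).subset fun J (hJ : Refines I J) => by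
    change weight J ≤ weight I
    rw [weight_eq_wt_colSum, weight_eq_wt_colSum, hJ.colSum_eq]

/-- The quasi-ribbon function `F_I = ∑_{I ≼ J} M_J`. -/
noncomputable def F {ℓ : ℕ} (I : VComp ℓ) : QSym ℓ := ∑ J ∈ (finite_refines I).toFinset, M ℓ J

/-! ### The coalgebra structure -/

/-- The coproduct `Δ(M_I) = ∑_{I = JK} M_J ⊗ M_K`, the sum over all deconcatenations of `I`, and the
counit, the projection onto the component of multidegree zero. -/
noncomputable instance instCoalgebraStruct (ℓ : ℕ) : CoalgebraStruct ℚ (QSym ℓ) where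
  comul := (M ℓ).constr ℚ fun I =>
    ∑ r ∈ Finset.range (I.length + 1), M ℓ (I.take r) ⊗ₜ[ℚ] M ℓ (I.drop r)
  counit := (M ℓ).constr ℚ fun I => if I = [] then 1 else 0

theorem comul_M {ℓ : ℕ} (I : VComp ℓ) : Coalgebra.comul (R := ℚ) (M ℓ I) =
    ∑ r ∈ Finset.range (I.length + 1), M ℓ (I.take r) ⊗ₜ[ℚ] M ℓ (I.drop r) :=
  (M ℓ).constr_basis ℚ _ I

theorem counit_M {ℓ : ℕ} (I : VComp ℓ) :
    Coalgebra.counit (R := ℚ) (M ℓ I) = if I = [] then (1 : ℚ) else 0 :=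
  (M ℓ).constr_basis ℚ _ I

noncomputable instance instCoalgebra (ℓ : ℕ) : Coalgebra ℚ (QSym ℓ) where
  coassoc := by
    refine (M ℓ).ext fun I => ?_
    simp only [LinearMap.comp_apply, comul_M, map_sum, LinearMap.rTensor_tmul,
      LinearMap.lTensor_tmul, TensorProduct.sum_tmul, TensorProduct.tmul_sum,
      LinearEquiv.coe_coe, TensorProduct.assoc_tmul]
    rw [Finset.sum_sigma', Finset.sum_sigma']
    refine Finset.sum_bij' (fun x _ => ⟨x.2, x.1 - x.2⟩) (fun x _ => ⟨x.1 + x.2, x.1⟩)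
      ?_ ?_ ?_ ?_ ?_
    · rintro ⟨r, s⟩ h
      simp only [Finset.mem_sigma, Finset.mem_range, List.length_take, List.length_drop] at h ⊢
      omega
    · rintro ⟨r, s⟩ h
      simp only [Finset.mem_sigma, Finset.mem_range, List.length_take, List.length_drop] at h ⊢
      omega
    · rintro ⟨r, s⟩ h
      simp only [Finset.mem_sigma, Finset.mem_range, List.length_take] at h
      simp only [Sigma.mk.injEq, heq_eq_eq, and_true]
      omega
    · rintro ⟨r, s⟩ h
      simp
    · rintro ⟨r, s⟩ h
      simp only [Finset.mem_sigma, Finset.mem_range, List.length_take] at h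
      simp only [List.take_take, List.drop_take, List.drop_drop]
      rw [min_eq_left (by omega), show s + (r - s) = r by omega]
  rTensor_counit_comp_comul := by
    refine (M ℓ).ext fun I => ?_
    simp only [LinearMap.comp_apply, comul_M, map_sum, LinearMap.rTensor_tmul, counit_M]
    rw [Finset.sum_eq_single 0]
    · simp
    · intro r hr h0
      rw [Finset.mem_range] at hr
      rw [if_neg, TensorProduct.zero_tmul]
      intro h
      rw [List.take_eq_nil_iff] at h
      rcases h with h | h
      · exact h0 h
      · subst h; simp at hr; omega
    · simp
  lTensor_counit_comp_comul := by
    refine (M ℓ).ext fun I => ?_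
    simp only [LinearMap.comp_apply, comul_M, map_sum, LinearMap.lTensor_tmul, counit_M]
    rw [Finset.sum_eq_single I.length]
    · simp
    · intro r hr h0
      rw [Finset.mem_range] at hr
      rw [if_neg, TensorProduct.tmul_zero]
      intro h
      rw [List.drop_eq_nil_iff] at h
      omega
    · simp

/-- The convolution product `C → C ⊗ C → A ⊗ A → A` of linear maps from `QSym ℓ` to an algebra. -/
noncomputable def conv {ℓ : ℕ} {A : Type*} [Ring A] [Algebra ℚ A] (φ ψ : QSym ℓ →ₗ[ℚ] A) :
    QSym ℓ →ₗ[ℚ] A :=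
  LinearMap.mul' ℚ A ∘ₗ TensorProduct.map φ ψ ∘ₗ Coalgebra.comul

theorem conv_M {ℓ : ℕ} {A : Type*} [Ring A] [Algebra ℚ A] (φ ψ : QSym ℓ →ₗ[ℚ] A) (I : VComp ℓ) :
    conv φ ψ (M ℓ I) =
      ∑ r ∈ Finset.range (I.length + 1), φ (M ℓ (I.take r)) * ψ (M ℓ (I.drop r)) := by
  simp [conv, comul_M]

/-! ### The antipode -/

/-- The values of the antipode on the monomial basis, by the recursion for connected bialgebras. -/
noncomputable def antipodeM {ℓ : ℕ} (I : VComp ℓ) : QSym ℓ :=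
  if I = [] then 1
  else -∑ r : Fin I.length, antipodeM (I.take r) * M ℓ (I.drop r)
termination_by I.length
decreasing_by simp

/-- The antipode of `QSym ℓ`; it is the two-sided convolution inverse of the identity, as proved in
`antipode_conv_id` and `id_conv_antipode`. -/
noncomputable def antipode (ℓ : ℕ) : QSym ℓ →ₗ[ℚ] QSym ℓ := (M ℓ).constr ℚ antipodeM

/-- The recursively defined right convolution inverse of the identity. -/
noncomputable def antipodeM' {ℓ : ℕ} (I : VComp ℓ) : QSym ℓ :=
  if I = [] then 1
  else -∑ r : Fin I.length, M ℓ (I.take (r + 1)) * antipodeM' (I.drop (r + 1))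
termination_by I.length
decreasing_by
  have : 0 < I.length := r.pos
  simp only [List.length_drop]
  omega

theorem antipode_conv_id (ℓ : ℕ) :
    conv (antipode ℓ) LinearMap.id = Algebra.linearMap ℚ (QSym ℓ) ∘ₗ Coalgebra.counit := by
  refine (M ℓ).ext fun I => ?_
  have hS : ∀ J : VComp ℓ, antipode ℓ (M ℓ J) = antipodeM J := fun J => (M ℓ).constr_basis ℚ _ J
  rw [conv_M, LinearMap.comp_apply, counit_M]
  simp only [hS, LinearMap.id_apply]
  rw [Finset.sum_range_succ, List.take_length, List.drop_length, M_nil, mul_one]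
  by_cases hI : I = []
  · subst hI
    rw [antipodeM]
    simp
  · conv_lhs => rw [antipodeM]
    rw [if_neg hI, if_neg hI, map_zero,
      ← Fin.sum_univ_eq_sum_range (fun r => antipodeM (I.take r) * M ℓ (I.drop r))]
    exact add_neg_cancel _

theorem conv_antipodeM' (ℓ : ℕ) :
    conv LinearMap.id ((M ℓ).constr ℚ antipodeM') =
      Algebra.linearMap ℚ (QSym ℓ) ∘ₗ Coalgebra.counit := by
  refine (M ℓ).ext fun I => ?_
  rw [conv_M, LinearMap.comp_apply, counit_M]
  simp only [Module.Basis.constr_basis, LinearMap.id_apply]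
  rw [Finset.sum_range_succ', List.take_zero, List.drop_zero, M_nil, one_mul]
  by_cases hI : I = []
  · subst hI
    rw [antipodeM']
    simp
  · conv_lhs => rw [antipodeM']
    rw [if_neg hI, if_neg hI, map_zero,
      ← Fin.sum_univ_eq_sum_range (fun r => M ℓ (I.take (r + 1)) * antipodeM' (I.drop (r + 1)))]
    exact add_neg_cancel _

theorem id_conv_antipode (ℓ : ℕ) :
    conv LinearMap.id (antipode ℓ) = Algebra.linearMap ℚ (QSym ℓ) ∘ₗ Coalgebra.counit := by
  have h1 : WithConv.toConv (antipode ℓ) * WithConv.toConv LinearMap.id = 1 :=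
    congrArg WithConv.toConv (antipode_conv_id ℓ)
  have h2 : WithConv.toConv (LinearMap.id : QSym ℓ →ₗ[ℚ] QSym ℓ) *
      WithConv.toConv ((M ℓ).constr ℚ antipodeM') = 1 :=
    congrArg WithConv.toConv (conv_antipodeM' ℓ)
  have h3 := left_inv_eq_right_inv h1 h2
  have h4 : antipode ℓ = (M ℓ).constr ℚ antipodeM' := congrArg WithConv.ofConv h3
  rw [h4]
  exact conv_antipodeM' ℓ

/-! ### The functionals -/

/-- The universal character: `ζ(M_I)` is `1` if `I` has at most one column, and `0` otherwise. -/
noncomputable def zetaQ (ℓ : ℕ) : QSym ℓ →ₗ[ℚ] ℚ :=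
  (M ℓ).constr ℚ fun I => if I.length ≤ 1 then 1 else 0

open Classical in
/-- The functional `ζ^k`, which on the component of multidegree `n` (spanned by the `M_I` with
`ΣI = n`) is `(-1)^{|n|} ζ` if `n ≤ k`, and `ζ` otherwise. -/
noncomputable def zetaK {ℓ : ℕ} (k : Fin ℓ → ℕ∞) : QSym ℓ →ₗ[ℚ] ℚ :=
  (M ℓ).constr ℚ fun I =>
    if LeExt (colSum I) k then (-1) ^ wt (colSum I) * zetaQ ℓ (M ℓ I) else zetaQ ℓ (M ℓ I)

/-- The multidegree of a monomial. -/
def mdeg {ℓ : ℕ} (d : (ℕ × Fin ℓ) →₀ ℕ) : Fin ℓ → ℕ := d.sum fun p m => Pi.single p.2 m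

theorem mdeg_expo {ℓ : ℕ} (I : VComp ℓ) (j : Fin I.length → ℕ) : mdeg (expo I j) = colSum I := by
  have hadd : ∀ a b : (ℕ × Fin ℓ) →₀ ℕ, mdeg (a + b) = mdeg a + mdeg b := fun a b =>
    Finsupp.sum_add_index' (fun p => Pi.single_zero p.2) (fun p m n => Pi.single_add (f := fun _ => ℕ) p.2 m n)
  let g : ((ℕ × Fin ℓ) →₀ ℕ) →+ (Fin ℓ → ℕ) :=
    { toFun := mdeg, map_zero' := Finsupp.sum_zero_index, map_add' := hadd }
  have hs : ∀ (p : ℕ × Fin ℓ) (m : ℕ), g (Finsupp.single p m) = Pi.single p.2 m := fun p m =>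
    Finsupp.sum_single_index (Pi.single_zero p.2)
  change g (expo I j) = colSum I
  unfold expo colSum
  simp only [map_sum, hs, Finset.univ_sum_single]
  rw [← List.sum_ofFn]
  congr 1
  exact List.ext_getElem (by simp) fun n h1 h2 => by simp

/-- `ζ^k` agrees with `(-1)^{|n|} ζ` or with `ζ` on homogeneous elements of multidegree `n`. -/
theorem zetaK_of_homogeneous {ℓ : ℕ} (k : Fin ℓ → ℕ∞) (n : Fin ℓ → ℕ) (f : QSym ℓ)
    (hf : ∀ d, MvPowerSeries.coeff d f.1 ≠ 0 → mdeg d = n) :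
    (LeExt n k → zetaK k f = (-1) ^ wt n * zetaQ ℓ f) ∧
      (¬ LeExt n k → zetaK k f = zetaQ ℓ f) := by
  classical
  have hr : ∀ I ∈ ((M ℓ).repr f).support, colSum I = n := fun I hI => by
    rw [← mdeg_expo I fun r => (r : ℕ)]
    refine hf _ ?_
    rw [← coordMap_apply]
    exact Finsupp.mem_support_iff.1 hI
  have hk : ∀ I, zetaK k (M ℓ I) = if LeExt (colSum I) k then
      (-1) ^ wt (colSum I) * zetaQ ℓ (M ℓ I) else zetaQ ℓ (M ℓ I) := fun I =>
    (M ℓ).constr_basis ℚ _ I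
  constructor <;> intro h <;> rw [← (M ℓ).linearCombination_repr f,
    Finsupp.linearCombination_apply, Finsupp.sum, map_sum, map_sum]
  · rw [Finset.mul_sum]
    refine Finset.sum_congr rfl fun I hI => ?_
    rw [map_smul, map_smul, hk, hr I hI, if_pos h, smul_eq_mul, smul_eq_mul]
    ring
  · refine Finset.sum_congr rfl fun I hI => ?_
    rw [map_smul, map_smul, hk, hr I hI, if_neg h]

/-- The `k`-odd functional `ν^k = (ζ^k ∘ S) ζ`. -/
noncomputable def nuQ {ℓ : ℕ} (k : Fin ℓ → ℕ∞) : QSym ℓ →ₗ[ℚ] ℚ :=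
  conv (zetaK k ∘ₗ antipode ℓ) (zetaQ ℓ)

/-- `(e, i - e)` is a vector composition with `i ≼ (e, i - e)`, where `e` is a coordinate vector. -/
def SplitsOff {ℓ : ℕ} (i e : Col ℓ) : Prop :=
  IsCoord e ∧ ∃ v : Col ℓ, i.1 = e.1 + v.1 ∧ Refines [i] [e, v]

end LevelQSym

namespace LevelQSym

open Finset

variable {ℓ : ℕ}

/-! On quasisymmetric functions, `zetaQ` is the evaluation setting the first variable of each color
to 1 and all others to 0. It is therefore a character, and the recursion for the antipode gives
`zetaQ (S M_I) = (-1)^len(I)`. Since `S` preserves the multidegree, `zetaK k (S M_I) = (-1)^len(I)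
ε(ΣI)`, where `ε(n)` is `(-1)^|n|` if `n ≤ k` and 1 otherwise (`truncSign`). In the convolution with
`zetaQ` only the deconcatenations whose right factor has at most one column survive, so for `J ≠ []`
the value at `M_J` is `(-1)^len(J) (ε(ΣJ) - ε(ΣJ without the last column))` (`nuQ_M`, `lastDiff`).
The monomial formula follows by cases.

For `F_I`, split the first column as `i = e + v`, where `e` is the coordinate vector of the least
color in the support. The refinements of `(i, I)` come in pairs from those of `(v, I)`: put `e` in
front, or add it to the first column (`refines_cons_iff_of_first`). The two members of a pair cancel
unless the refinement of `(v, I)` is a single column. So a column of weight above 1 before the last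
one kills the sum, while a coordinate column only translates `ε` and flips the sign. What remains
for `(E, i)` is `(-1)^|E| (ε(ΣE) - ε(ΣE + e))`, with `e` the first letter of `i`
(`sum_lastDiff_append_singleton`); this is 0 or 2. -/

/-! ### The universal character is multiplicative -/

/-- The embedding of the first group of variables into all variables. -/
def firstRow (ℓ : ℕ) : Fin ℓ ↪ ℕ × Fin ℓ := ⟨fun c => (0, c), fun _ _ h => (Prod.mk.inj h).2⟩

/-- The polynomial obtained from a quasisymmetric function by setting all variables outside of the
first group to zero. -/
noncomputable def restrictFirst (f : QSym ℓ) : MvPolynomial (Fin ℓ) ℚ :=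
  AddMonoidAlgebra.ofCoeff <| Finsupp.ofSupportFinite (fun v : Fin ℓ →₀ ℕ =>
    MvPowerSeries.coeff (v.embDomain (firstRow ℓ)) f.1) (by
    obtain ⟨N, hN⟩ := f.2.1
    -- A degree bound bounds each of the finitely many exponents, so only finitely many monomials in
    -- the first group occur.
    refine (Set.finite_Iic (Finsupp.equivFunOnFinite.symm fun _ : Fin ℓ => N)).subset
      fun v hv => ?_
    have h := hN _ hv
    rw [Set.mem_Iic, Finsupp.le_def]
    intro c
    have h1 := Finsupp.le_degree (firstRow ℓ c) (v.embDomain (firstRow ℓ))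
    rw [Finsupp.embDomain_apply_self] at h1
    exact h1.trans h)

theorem coeff_restrictFirst (f : QSym ℓ) (v : Fin ℓ →₀ ℕ) :
    (restrictFirst f).coeff v = MvPowerSeries.coeff (v.embDomain (firstRow ℓ)) f.1 := rfl

/-- A monomial in the first group of variables factors only into monomials in the first group, so
the discarded coefficients never contribute. -/
theorem restrictFirst_mul (f g : QSym ℓ) :
    restrictFirst (f * g) = restrictFirst f * restrictFirst g := by
  classical
  ext v
  rw [MvPolynomial.coeff_mul, coeff_restrictFirst, MulMemClass.coe_mul, MvPowerSeries.coeff_mul,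
    ← Finsupp.image_prodMap_embDomain_antidiagonal, Finset.sum_image]
  · rfl
  · rintro ⟨a, b⟩ _ ⟨a', b'⟩ _ h
    simp only [Prod.map, Prod.mk.injEq, Finsupp.embDomain_inj] at h
    exact Prod.ext h.1 h.2

/-- Restriction to the first group of variables as a linear map. -/
noncomputable def restrictFirstLin (ℓ : ℕ) : QSym ℓ →ₗ[ℚ] MvPolynomial (Fin ℓ) ℚ where
  toFun := restrictFirst
  map_add' f g := by
    ext v
    rw [MvPolynomial.coeff_add]
    exact (MvPowerSeries.coeff (v.embDomain (firstRow ℓ))).map_add f.1 g.1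
  map_smul' a f := by
    ext v
    rw [MvPolynomial.coeff_smul]
    exact (MvPowerSeries.coeff (v.embDomain (firstRow ℓ))).map_smul a f.1

/-- Identifies the nonconstant monomials in the first group with the one-column compositions, so
that `coeff_monomialSeries` computes the restriction of every `M_I`. -/
theorem embDomain_firstRow (v : Col ℓ) :
    (Finsupp.equivFunOnFinite.symm v.1).embDomain (firstRow ℓ) =
      expo [v] fun r => (r : ℕ) := by
  classical
  ext ⟨n, c⟩
  by_cases hn : n = 0
  · subst hn
    have h1 := expo_apply [v] (strictMono_val 1) 0 c
    have h2 := Finsupp.embDomain_apply_self (firstRow ℓ) (Finsupp.equivFunOnFinite.symm v.1) c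
    exact h2.trans h1.symm
  · rw [expo_apply_of_notMem]
    · refine Finsupp.embDomain_of_notMem_range _ _ _ ?_
      rintro ⟨c', h⟩
      exact hn (Prod.mk.inj h).1.symm
    · rintro ⟨r, h⟩
      have := r.2
      simp only [List.length_cons, List.length_nil] at this h
      omega

theorem restrictFirst_M_nil : restrictFirst (M ℓ []) = 1 := by
  classical
  ext v
  rw [coeff_restrictFirst, M_nil, OneMemClass.coe_one, MvPowerSeries.coeff_one,
    MvPolynomial.coeff_one]
  congr 1
  rw [← Finsupp.embDomain_zero (firstRow ℓ), Finsupp.embDomain_inj]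
  exact propext eq_comm

theorem restrictFirst_M_singleton (i : Col ℓ) :
    restrictFirst (M ℓ [i]) = MvPolynomial.monomial (Finsupp.equivFunOnFinite.symm i.1) 1 := by
  classical
  ext v
  rw [coeff_restrictFirst, coe_M, MvPolynomial.coeff_monomial]
  by_cases hv : v = 0
  · subst hv
    have h0 : (0 : Fin ℓ →₀ ℕ).embDomain (firstRow ℓ) =
        expo ([] : VComp ℓ) fun r => (r : ℕ) := by simp [expo]
    rw [h0, coeff_monomialSeries _ _ (strictMono_val _), if_neg (by simp), if_neg]
    intro h
    exact i.2 (funext fun c => DFunLike.congr_fun h c)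
  · have hv' : (v : Fin ℓ → ℕ) ≠ 0 := fun h => hv (DFunLike.coe_injective h)
    have h1 := embDomain_firstRow (⟨v, hv'⟩ : Col ℓ)
    rw [Finsupp.equivFunOnFinite_symm_coe] at h1
    rw [h1, coeff_monomialSeries _ _ (strictMono_val _)]
    congr 1
    rw [List.cons.injEq, Subtype.ext_iff]
    refine propext ⟨fun h => ?_, fun h => ⟨?_, rfl⟩⟩
    · rw [h.1, Finsupp.equivFunOnFinite_symm_coe]
    · exact funext fun c => DFunLike.congr_fun h c

theorem restrictFirst_M_of_two_le {I : VComp ℓ} (hI : 2 ≤ I.length) :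
    restrictFirst (M ℓ I) = 0 := by
  classical
  ext v
  rw [coeff_restrictFirst, coe_M, MvPolynomial.coeff_zero]
  by_cases hv : v = 0
  · subst hv
    have h0 : (0 : Fin ℓ →₀ ℕ).embDomain (firstRow ℓ) =
        expo ([] : VComp ℓ) fun r => (r : ℕ) := by simp [expo]
    rw [h0, coeff_monomialSeries _ _ (strictMono_val _), if_neg]
    rintro rfl
    simp at hI
  · have hv' : (v : Fin ℓ → ℕ) ≠ 0 := fun h => hv (DFunLike.coe_injective h)
    have h1 := embDomain_firstRow (⟨v, hv'⟩ : Col ℓ)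
    rw [Finsupp.equivFunOnFinite_symm_coe] at h1
    rw [h1, coeff_monomialSeries _ _ (strictMono_val _), if_neg]
    rintro rfl
    simp at hI

theorem zetaQ_M (I : VComp ℓ) : zetaQ ℓ (M ℓ I) = if I.length ≤ 1 then 1 else 0 :=
  (M ℓ).constr_basis ℚ _ I

/-- The universal character sets the first variable of each color to one, the others to zero. -/
theorem zetaQ_eq_eval (f : QSym ℓ) :
    zetaQ ℓ f = MvPolynomial.aeval (fun _ => (1 : ℚ)) (restrictFirst f) := by
  have h : zetaQ ℓ =
      (MvPolynomial.aeval fun _ : Fin ℓ => (1 : ℚ)).toLinearMap ∘ₗ restrictFirstLin ℓ := by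
    refine (M ℓ).ext fun I => ?_
    change _ = MvPolynomial.aeval (fun _ => (1 : ℚ)) (restrictFirst (M ℓ I))
    rw [zetaQ_M]
    match I with
    | [] => simp [restrictFirst_M_nil]
    | [i] => simp [restrictFirst_M_singleton, MvPolynomial.aeval_monomial]
    | a :: b :: I => rw [restrictFirst_M_of_two_le (by simp)]; simp
  rw [h]
  rfl

/-- Restriction and evaluation are both multiplicative, so the quasi-shuffle expansion of products
of the `M_I` is not needed. -/
theorem zetaQ_mul (f g : QSym ℓ) : zetaQ ℓ (f * g) = zetaQ ℓ f * zetaQ ℓ g := by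
  simp only [zetaQ_eq_eval, restrictFirst_mul, map_mul]

/-! ### The antipode -/

theorem antipode_M (I : VComp ℓ) : antipode ℓ (M ℓ I) = antipodeM I :=
  (M ℓ).constr_basis ℚ _ I

theorem colSum_append (I J : VComp ℓ) : colSum (I ++ J) = colSum I + colSum J := by
  simp [colSum]

theorem colSum_cons (i : Col ℓ) (I : VComp ℓ) : colSum (i :: I) = i.1 + colSum I := by
  simp [colSum]

@[simp]
theorem colSum_nil : colSum ([] : VComp ℓ) = 0 := rfl

theorem zetaQ_antipodeM (I : VComp ℓ) : zetaQ ℓ (antipodeM I) = (-1) ^ I.length := by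
  rw [antipodeM]
  by_cases hI : I = []
  · subst hI
    rw [if_pos rfl, ← M_nil, zetaQ_M]
    simp
  · have hpos : 0 < I.length := List.length_pos_iff.2 hI
    -- Only proper prefixes occur in the recursion, and `zetaQ` kills every complementary suffix
    -- with two or more columns; the prefix lacking just the last column remains.
    rw [if_neg hI, map_neg, map_sum, Finset.sum_eq_single ⟨I.length - 1, by omega⟩]
    · rw [zetaQ_mul, zetaQ_M, zetaQ_antipodeM, if_pos (by simp; omega), mul_one,
        List.length_take, Nat.min_eq_left (by simp)]
      obtain ⟨n, hn⟩ := Nat.exists_eq_succ_of_ne_zero hpos.ne'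
      simp [hn, pow_succ]
    · intro r _ hr
      have hr' : (r : ℕ) ≠ I.length - 1 := fun h => hr (Fin.ext h)
      rw [zetaQ_mul, zetaQ_M, if_neg, mul_zero]
      rw [List.length_drop]
      omega
    · simp
termination_by I.length
decreasing_by simp; omega

/-! ### The multigrading and its preservation by the antipode. -/

theorem mdeg_add (a b : (ℕ × Fin ℓ) →₀ ℕ) : mdeg (a + b) = mdeg a + mdeg b :=
  Finsupp.sum_add_index' (fun p => Pi.single_zero p.2)
    (fun p m n => Pi.single_add (f := fun _ => ℕ) p.2 m n)

/-- The component of multidegree `n`. -/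
def homogeneousComponent (n : Fin ℓ → ℕ) : Submodule ℚ (QSym ℓ) where
  carrier := {f | ∀ d, MvPowerSeries.coeff d f.1 ≠ 0 → mdeg d = n}
  zero_mem' d hd := absurd (map_zero _) hd
  add_mem' {f g} hf hg d hd := by
    by_cases h : MvPowerSeries.coeff d f.1 = 0
    · refine hg d fun h' => hd ?_
      rw [AddMemClass.coe_add, map_add, h, h', add_zero]
    · exact hf d h
  smul_mem' a f hf d hd := hf d fun h => hd (by
    rw [SetLike.val_smul, MvPowerSeries.coeff_smul, h, mul_zero])

theorem mul_mem_homogeneousComponent {m n : Fin ℓ → ℕ} {f g : QSym ℓ}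
    (hf : f ∈ homogeneousComponent m) (hg : g ∈ homogeneousComponent n) :
    f * g ∈ homogeneousComponent (m + n) := by
  classical
  intro d hd
  rw [MulMemClass.coe_mul, MvPowerSeries.coeff_mul] at hd
  obtain ⟨p, hp, hne⟩ := Finset.exists_ne_zero_of_sum_ne_zero hd
  rw [Finset.HasAntidiagonal.mem_antidiagonal] at hp
  rw [← hp, mdeg_add, hf _ (left_ne_zero_of_mul hne), hg _ (right_ne_zero_of_mul hne)]

theorem M_mem_homogeneousComponent (I : VComp ℓ) : M ℓ I ∈ homogeneousComponent (colSum I) := by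
  classical
  intro d hd
  obtain ⟨J, j, hj, rfl⟩ := exists_expo d
  rw [coe_M, coeff_monomialSeries I J hj] at hd
  obtain rfl : I = J := by by_contra h; simp [h] at hd
  exact mdeg_expo I j

/-- `zetaK k` need not be multiplicative and cannot be pushed through the recursion for the
antipode. Homogeneity replaces it by `zetaQ` up to a sign, through `zetaK_of_homogeneous`. -/
theorem antipodeM_mem_homogeneousComponent (I : VComp ℓ) :
    antipodeM I ∈ homogeneousComponent (colSum I) := by
  rw [antipodeM]
  by_cases hI : I = []
  · subst hI
    rw [if_pos rfl, ← M_nil]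
    exact M_mem_homogeneousComponent []
  · rw [if_neg hI]
    refine Submodule.neg_mem _ (Submodule.sum_mem _ fun r _ => ?_)
    have h : colSum I = colSum (I.take r) + colSum (I.drop r) := by
      rw [← colSum_append, List.take_append_drop]
    rw [h]
    exact mul_mem_homogeneousComponent (antipodeM_mem_homogeneousComponent (I.take r))
      (M_mem_homogeneousComponent _)
termination_by I.length
decreasing_by simp

/-! ### The values on the monomial basis -/

open Classical in
/-- The sign by which `ζ^k` differs from `ζ` in multidegree `n`. -/
noncomputable def truncSign (k : Fin ℓ → ℕ∞) (n : Fin ℓ → ℕ) : ℚ :=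
  if LeExt n k then (-1) ^ wt n else 1

theorem zetaK_antipode_M (k : Fin ℓ → ℕ∞) (I : VComp ℓ) :
    zetaK k (antipode ℓ (M ℓ I)) = (-1) ^ I.length * truncSign k (colSum I) := by
  have h := zetaK_of_homogeneous k (colSum I) (antipodeM I)
    (antipodeM_mem_homogeneousComponent I)
  rw [antipode_M, truncSign]
  split_ifs with hk
  · rw [h.1 hk, zetaQ_antipodeM, mul_comm]
  · rw [h.2 hk, zetaQ_antipodeM, mul_one]

/-- The signed difference of the values of `ε` at `ΣJ` and at the sum of all columns of `J` but
the last one. -/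
noncomputable def lastDiff (ε : (Fin ℓ → ℕ) → ℚ) (J : VComp ℓ) : ℚ :=
  (-1) ^ J.length * (ε (colSum J) - ε (colSum J.dropLast))

theorem nuQ_M_nil (k : Fin ℓ → ℕ∞) : nuQ k (M ℓ []) = 1 := by
  simp only [nuQ, conv_M, LinearMap.comp_apply, zetaK_antipode_M, zetaQ_M]
  simp [truncSign, wt]

theorem nuQ_M {J : VComp ℓ} (k : Fin ℓ → ℕ∞) (hJ : J ≠ []) :
    nuQ k (M ℓ J) = lastDiff (truncSign k) J := by
  obtain ⟨n, hn⟩ := Nat.exists_eq_succ_of_ne_zero (List.length_pos_iff.2 hJ).ne'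
  simp only [nuQ, conv_M, LinearMap.comp_apply, zetaK_antipode_M, zetaQ_M, lastDiff]
  -- The two summands split off are those whose right factor is empty or the last column; all others
  -- have a right factor with at least two columns.
  rw [hn, Finset.sum_range_succ, Finset.sum_range_succ, Finset.sum_eq_zero]
  · simp only [List.length_take, List.length_drop, hn]
    rw [List.take_of_length_le (show J.length ≤ n + 1 by omega), if_pos (by omega), if_pos (by omega),
      List.dropLast_eq_take, hn]
    simp only [Nat.succ_eq_add_one, Nat.add_sub_cancel, min_self,
      min_eq_left (Nat.le_succ n), pow_succ]
    ring
  · intro r hr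
    rw [Finset.mem_range] at hr
    rw [if_neg, mul_zero]
    rw [List.length_drop]
    omega

theorem LeExt.mono {k : Fin ℓ → ℕ∞} {m n : Fin ℓ → ℕ} (h : LeExt n k) (hmn : m ≤ n) :
    LeExt m k := fun c => le_trans (by exact_mod_cast hmn c) (h c)

theorem wt_add (m n : Fin ℓ → ℕ) : wt (m + n) = wt m + wt n := Finset.sum_add_distrib

theorem wt_pos (v : Col ℓ) : 0 < wt v.1 := by
  obtain ⟨c, hc⟩ := Function.ne_iff.mp v.2
  exact lt_of_lt_of_le (Nat.pos_of_ne_zero hc)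
    (Finset.single_le_sum (f := v.1) (fun _ _ => Nat.zero_le _) (Finset.mem_univ c))

-- Boundedness by `k` passes to smaller vectors, so only three situations arise: `ΣJ + i ≤ k`, only
-- `ΣJ ≤ k`, or neither. The two values of `ε` then differ according to the parity of `|i|`,
-- according to that of `|J|`, or not at all.
open Classical in
theorem nuQ_M_append_singleton (k : Fin ℓ → ℕ∞) (J : VComp ℓ) (i : Col ℓ) :
    nuQ k (M ℓ (J ++ [i])) =
      if Odd (wt i.1) ∧ LeExt (colSum (J ++ [i])) k then
        2 * (-1) ^ ((J ++ [i]).length + weight (J ++ [i]))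
      else if Odd (weight (J ++ [i]) - wt i.1) ∧ LeExt (colSum (J ++ [i]) - i.1) k ∧
          ¬ LeExt (colSum (J ++ [i])) k then
        2 * (-1) ^ (J ++ [i]).length
      else 0 := by
  have hs : colSum (J ++ [i]) = colSum J + i.1 := by simp [colSum_append, colSum_cons]
  have hw : weight (J ++ [i]) = weight J + wt i.1 := by simp [weight]
  have h1 : LeExt (colSum J + i.1) k → LeExt (colSum J) k := fun h => h.mono le_self_add
  rw [nuQ_M k (by simp), lastDiff, List.dropLast_concat, truncSign, truncSign, hs, hw,
    show colSum J + i.1 - i.1 = colSum J from funext fun c => Nat.add_sub_cancel ..,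
    Nat.add_sub_cancel,
    wt_add, ← weight_eq_wt_colSum]
  by_cases hI : LeExt (colSum J + i.1) k
  · rcases Nat.even_or_odd (wt i.1) with he | ho
    · simp [hI, h1 hI, pow_add, he.neg_one_pow, Nat.not_odd_iff_even.2 he]
    · simp only [hI, h1 hI, pow_add, ho.neg_one_pow, ho, if_true, and_self]
      ring
  · by_cases hJ : LeExt (colSum J) k
    · rcases Nat.even_or_odd (weight J) with he | ho
      · simp [hI, hJ, he.neg_one_pow, Nat.not_odd_iff_even.2 he]
      · simp only [hI, hJ, ho.neg_one_pow, ho, if_true, if_false, and_true, and_false,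
          not_false_eq_true]
        ring
    · simp [hI, hJ]

/-! ### The refinement order -/

/-- Every element of the support of `a` is at most every element of the support of `b`. -/
def SupportLE (a b : Col ℓ) : Prop := ∀ p q : Fin ℓ, a.1 p ≠ 0 → b.1 q ≠ 0 → p ≤ q

theorem refines_nil_iff {J : VComp ℓ} : Refines [] J ↔ J = [] := by
  constructor
  · rintro ⟨L, rfl, hL⟩
    rw [List.forall₂_nil_right_iff] at hL
    simp [hL]
  · rintro rfl
    exact ⟨[], rfl, .nil⟩

theorem refines_cons_iff {i : Col ℓ} {I J : VComp ℓ} :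
    Refines (i :: I) J ↔ ∃ K J' : VComp ℓ, J = K ++ J' ∧ colSum K = i.1 ∧
      K.Pairwise SupportLE ∧ Refines I J' := by
  constructor
  · rintro ⟨L, rfl, hL⟩
    obtain ⟨K, L', h1, h2, rfl⟩ := List.forall₂_cons_right_iff.1 hL
    exact ⟨K, L'.flatten, rfl, h1.1, h1.2, L', rfl, h2⟩
  · rintro ⟨K, _, rfl, h1, h2, L, rfl, hL⟩
    exact ⟨K :: L, rfl, .cons ⟨h1, h2⟩ hL⟩

theorem refines_singleton_pair_iff {i a b : Col ℓ} :
    Refines [i] [a, b] ↔ a.1 + b.1 = i.1 ∧ SupportLE a b := by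
  simp only [refines_cons_iff, refines_nil_iff]
  constructor
  · rintro ⟨K, _, h, h1, h2, rfl⟩
    rw [List.append_nil] at h
    subst h
    refine ⟨by simpa [colSum_cons] using h1, by simpa using h2⟩
  · rintro ⟨h1, h2⟩
    exact ⟨[a, b], [], rfl, by simpa [colSum_cons] using h1, by simpa using h2, rfl⟩

theorem splitsOff_iff {i e : Col ℓ} :
    SplitsOff i e ↔ ∃ c : Fin ℓ, e.1 = Pi.single c 1 ∧ ∃ v : Col ℓ, i.1 = e.1 + v.1 ∧
      ∀ q, v.1 q ≠ 0 → c ≤ q := by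
  unfold SplitsOff IsCoord
  simp only [refines_singleton_pair_iff, SupportLE]
  constructor
  · rintro ⟨⟨c, hc⟩, v, h1, -, h2⟩
    exact ⟨c, hc, v, h1, fun q => h2 c q (by simp [hc])⟩
  · rintro ⟨c, hc, v, h1, h2⟩
    refine ⟨⟨c, hc⟩, v, h1, h1.symm, fun p q hp => ?_⟩
    obtain rfl : p = c := by
      by_contra h
      exact hp (by simp [hc, h])
    exact h2 q

theorem wt_single (c : Fin ℓ) (n : ℕ) : wt (Pi.single c n) = n := by
  simp [wt]

/-- The color of `e` must be the least one in the support of `i`: any other choice leaves the least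
color in the remainder, to the right of a larger one. Weight above 1 keeps the remainder nonzero. -/
theorem existsUnique_splitsOff {i : Col ℓ} (hi : 1 < wt i.1) : ∃! e : Col ℓ, SplitsOff i e := by
  classical
  obtain ⟨c₀, hc₀⟩ := Function.ne_iff.mp i.2
  obtain ⟨c, hc, hmin⟩ := Finset.exists_min_image
    (Finset.univ.filter fun c => i.1 c ≠ 0) id ⟨c₀, by simpa using hc₀⟩
  simp only [Finset.mem_filter, Finset.mem_univ, true_and, id_eq] at hc hmin
  have hle : (Pi.single c 1 : Fin ℓ → ℕ) ≤ i.1 := by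
    intro q
    by_cases h : q = c
    · subst h
      simpa using Nat.one_le_iff_ne_zero.2 hc
    · simp [h]
  have hsum := add_tsub_cancel_of_le hle
  refine ⟨⟨Pi.single c 1, by simp⟩, splitsOff_iff.2 ⟨c, rfl,
    ⟨i.1 - Pi.single c 1, fun h => ?_⟩, hsum.symm, fun q hq => hmin q ?_⟩, fun e he => ?_⟩
  · have h2 : i.1 = Pi.single c 1 := by simpa [h] using hsum.symm
    rw [h2, wt_single] at hi
    exact lt_irrefl _ hi
  · intro h
    exact hq (by simp [h])
  · obtain ⟨d, hd, v, h1, h2⟩ := splitsOff_iff.1 he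
    refine Subtype.ext ?_
    rw [hd]
    have h3 : c ≤ d := hmin d (by simp [h1, hd])
    have h4 : d ≤ c := by
      by_contra h
      have hne : c ≠ d := by rintro rfl; exact h le_rfl
      refine h (h2 c ?_)
      simpa [h1, hd, hne] using hc
    rw [le_antisymm h3 h4]

theorem weight_eq_zero {I : VComp ℓ} (h : weight I = 0) : I = [] := by
  match I with
  | [] => rfl
  | a :: I =>
    have := wt_pos a
    simp only [weight, List.map_cons, List.sum_cons] at h
    omega

/-- A column of weight 1 cannot be broken up, since every column of its block has positive weight.
-/
theorem refines_cons_iff_of_isCoord {e : Col ℓ} (he : IsCoord e) {I J : VComp ℓ} :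
    Refines (e :: I) J ↔ ∃ J', Refines I J' ∧ e :: J' = J := by
  rw [refines_cons_iff]
  constructor
  · rintro ⟨K, J', rfl, h1, -, h3⟩
    obtain ⟨c, hc⟩ := he
    match K with
    | [] => exact absurd h1.symm e.2
    | a :: K =>
      rw [colSum_cons] at h1
      have hw := congrArg wt h1
      rw [hc, wt_single, wt_add, ← weight_eq_wt_colSum] at hw
      have := wt_pos a
      obtain rfl := weight_eq_zero (I := K) (by omega)
      obtain rfl : a = e := Subtype.ext (by simpa using h1)
      exact ⟨J', h3, rfl⟩
  · rintro ⟨J', h, rfl⟩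
    exact ⟨[e], J', rfl, by simp [colSum_cons], by simp, h⟩

/-! ### Splitting the first letter off the first column of a refinement. -/

/-- The sum of two columns. -/
def addCol (a b : Col ℓ) : Col ℓ :=
  ⟨a.1 + b.1, fun h => a.2 (by simpa using (add_eq_zero.1 h).1)⟩

/-- Add a column to the first column of a vector composition. -/
def addHead (e : Col ℓ) : VComp ℓ → VComp ℓ
  | [] => []
  | a :: J => addCol e a :: J

theorem addCol_injective (e : Col ℓ) : Function.Injective (addCol e) := fun _ _ h =>
  Subtype.ext (add_left_cancel (congrArg Subtype.val h))

theorem addHead_injective (e : Col ℓ) : Function.Injective (addHead e) := by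
  intro J J' h
  match J, J' with
  | [], [] => rfl
  | [], _ :: _ => simp [addHead] at h
  | _ :: _, [] => simp [addHead] at h
  | a :: J, b :: J' =>
    simp only [addHead, List.cons.injEq] at h
    rw [addCol_injective e h.1, h.2]

theorem cons_ne_addHead (e : Col ℓ) (J J' : VComp ℓ) : e :: J ≠ addHead e J' := by
  match J' with
  | [] => simp [addHead]
  | a :: J' =>
    intro h
    have h1 := congrArg Subtype.val (List.cons.inj h).1
    exact a.2 (by simpa [addCol] using h1)

theorem le_colSum_of_mem {a : Col ℓ} {K : VComp ℓ} (h : a ∈ K) : a.1 ≤ colSum K :=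
  List.single_le_sum (by simp) _ (List.mem_map_of_mem h)

theorem exists_mem_of_colSum_ne_zero {K : VComp ℓ} {c : Fin ℓ} (h : colSum K c ≠ 0) :
    ∃ a ∈ K, a.1 c ≠ 0 := by
  induction K with
  | nil => simp at h
  | cons a K ih =>
    by_cases ha : a.1 c = 0
    · rw [colSum_cons, Pi.add_apply, ha, zero_add] at h
      obtain ⟨b, hb, h⟩ := ih h
      exact ⟨b, by simp [hb], h⟩
    · exact ⟨a, by simp, ha⟩

/-- In the block refining `i`, the least color `c` must occur in the first column `a`, so `e` can be
removed from `a`; the alternatives are `a = e` and `a - e ≠ 0`. Conversely, minimality of `c` makes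
both ways of putting `e` back respect the support condition. -/
theorem refines_cons_iff_of_first {i e v : Col ℓ} {c : Fin ℓ} (he : e.1 = Pi.single c 1)
    (hi : i.1 = e.1 + v.1) (hc : ∀ q, v.1 q ≠ 0 → c ≤ q) {I J : VComp ℓ} :
    Refines (i :: I) J ↔
      (∃ J', Refines (v :: I) J' ∧ e :: J' = J) ∨
        ∃ J', Refines (v :: I) J' ∧ addHead e J' = J := by
  have hce : ∀ q, e.1 q ≠ 0 → q = c := fun q hq => by
    by_contra h
    exact hq (by simp [he, h])
  have hmem : ∀ {K : VComp ℓ} {b : Col ℓ}, b ∈ K → colSum K = v.1 → ∀ q, b.1 q ≠ 0 → c ≤ q :=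
    fun {K b} hb hK q hq => hc q fun h => hq (by
      have := le_colSum_of_mem hb q
      rw [hK, h] at this
      exact Nat.le_zero.1 this)
  constructor
  · rw [refines_cons_iff]
    rintro ⟨K, J', rfl, h1, h2, h3⟩
    match K with
    | [] => exact absurd h1.symm i.2
    | a :: K =>
      rw [List.pairwise_cons] at h2
      rw [colSum_cons, hi] at h1
      have hsupp : ∀ q, a.1 q ≠ 0 → c ≤ q := fun q hq => by
        by_cases hv : v.1 q = 0
        · have := congrFun h1 q
          simp only [Pi.add_apply, hv, add_zero] at this
          exact (hce q (by omega)).ge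
        · exact hc q hv
      -- If `c` occurred only in later columns, the support of `a` would lie weakly below `c`; by
      -- `hsupp` it would then be `{c}`.
      have hac : a.1 c ≠ 0 := by
        intro h0
        have h := congrFun h1 c
        simp only [Pi.add_apply, h0, he, Pi.single_eq_same, zero_add] at h
        obtain ⟨b, hb, hbc⟩ := exists_mem_of_colSum_ne_zero (K := K) (c := c) (by omega)
        obtain ⟨p, hp⟩ := Function.ne_iff.mp a.2
        exact hp (by rw [le_antisymm (h2.1 b hb p c hp hbc) (hsupp p hp)]; exact h0)
      have hle : e.1 ≤ a.1 := by
        intro q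
        by_cases h : q = c
        · subst h
          simpa [he] using Nat.one_le_iff_ne_zero.2 hac
        · simp [he, h]
      have hsplit := add_tsub_cancel_of_le hle
      by_cases ha : a.1 - e.1 = 0
      · left
        obtain rfl : a = e := Subtype.ext (by simpa [ha] using hsplit.symm)
        exact ⟨K ++ J', refines_cons_iff.2 ⟨K, J', rfl, add_left_cancel h1, h2.2, h3⟩, rfl⟩
      · right
        refine ⟨⟨a.1 - e.1, ha⟩ :: (K ++ J'), refines_cons_iff.2
          ⟨⟨a.1 - e.1, ha⟩ :: K, J', rfl, ?_, List.pairwise_cons.2 ⟨?_, h2.2⟩, h3⟩, ?_⟩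
        · rw [colSum_cons]
          refine add_left_cancel (a := e.1) ?_
          rw [← add_assoc, hsplit, h1]
        · intro b hb p q hp
          refine h2.1 b hb p q fun h => hp ?_
          simp [h]
        · exact congrArg (· :: (K ++ J')) (Subtype.ext hsplit)
  · simp only [refines_cons_iff]
    rintro (⟨_, ⟨K, J', rfl, h1, h2, h3⟩, rfl⟩ | ⟨_, ⟨K, J', rfl, h1, h2, h3⟩, rfl⟩)
    · refine ⟨e :: K, J', rfl, by rw [colSum_cons, h1, hi],
        List.pairwise_cons.2 ⟨fun b hb p q hp hq => ?_, h2⟩, h3⟩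
      rw [hce p hp]
      exact hmem hb h1 q hq
    · match K with
      | [] => exact absurd h1.symm v.2
      | a :: K =>
        refine ⟨addCol e a :: K, J', rfl, ?_, ?_, h3⟩
        · rw [colSum_cons] at h1 ⊢
          rw [hi, ← h1, ← add_assoc]
          rfl
        · rw [List.pairwise_cons] at h2 ⊢
          refine ⟨fun b hb p q hp hq => ?_, h2.2⟩
          by_cases hap : a.1 p = 0
          · have hep : e.1 p ≠ 0 := fun h => hp (by simp [addCol, h, hap])
            rw [hce p hep]
            exact hmem (List.mem_cons_of_mem a hb) h1 q hq
          · exact h2.1 b hb p q hap hq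

theorem Refines.length_le {I J : VComp ℓ} (h : Refines I J) : I.length ≤ J.length := by
  induction I generalizing J with
  | nil => simp
  | cons i I ih =>
    obtain ⟨K, J', rfl, h1, -, h3⟩ := refines_cons_iff.1 h
    have hK : K ≠ [] := by
      rintro rfl
      exact i.2 h1.symm
    have := List.length_pos_iff.2 hK
    have := ih h3
    simp only [List.length_cons, List.length_append]
    omega

theorem Refines.refl (I : VComp ℓ) : Refines I I := by
  induction I with
  | nil => exact refines_nil_iff.2 rfl
  | cons i I ih => exact refines_cons_iff.2 ⟨[i], I, rfl, by simp [colSum_cons], by simp, ih⟩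

/-! ### Sums over all refinements. -/

/-- The finite set of all `J` with `I ≼ J`. -/
noncomputable def refinements (I : VComp ℓ) : Finset (VComp ℓ) := (finite_refines I).toFinset

theorem mem_refinements {I J : VComp ℓ} : J ∈ refinements I ↔ Refines I J := by
  simp [refinements]

theorem sum_refinements_of_isCoord {e : Col ℓ} (he : IsCoord e) (I : VComp ℓ)
    (g : VComp ℓ → ℚ) :
    ∑ J ∈ refinements (e :: I), g J = ∑ J ∈ refinements I, g (e :: J) := by
  classical
  have h : refinements (e :: I) = (refinements I).image (e :: ·) := by
    ext J
    simp only [mem_refinements, Finset.mem_image, refines_cons_iff_of_isCoord he]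
  rw [h, Finset.sum_image (List.cons_injective.injOn)]

theorem sum_refinements_of_first {i e v : Col ℓ} {c : Fin ℓ} (he : e.1 = Pi.single c 1)
    (hi : i.1 = e.1 + v.1) (hc : ∀ q, v.1 q ≠ 0 → c ≤ q) (I : VComp ℓ) (g : VComp ℓ → ℚ) :
    ∑ J ∈ refinements (i :: I), g J =
      ∑ J ∈ refinements (v :: I), (g (e :: J) + g (addHead e J)) := by
  classical
  have h : refinements (i :: I) =
      (refinements (v :: I)).image (e :: ·) ∪ (refinements (v :: I)).image (addHead e) := by
    ext J
    simp only [mem_refinements, Finset.mem_union, Finset.mem_image,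
      refines_cons_iff_of_first he hi hc]
  rw [h, Finset.sum_union, Finset.sum_image (List.cons_injective.injOn),
    Finset.sum_image (addHead_injective e).injOn, Finset.sum_add_distrib]
  rw [Finset.disjoint_left]
  intro J h1 h2
  obtain ⟨J₁, -, rfl⟩ := Finset.mem_image.1 h1
  obtain ⟨J₂, -, h⟩ := Finset.mem_image.1 h2
  exact cons_ne_addHead e J₁ J₂ h.symm

/-! ### The values on the quasi-ribbon functions -/

/-- The translate of a `truncSign` need not be one, hence the arbitrary `ε` in `lastDiff` and in the
sums below. -/
theorem lastDiff_cons (ε : (Fin ℓ → ℕ) → ℚ) (e : Col ℓ) {J : VComp ℓ} (hJ : J ≠ []) :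
    lastDiff ε (e :: J) = -lastDiff (fun n => ε (e.1 + n)) J := by
  simp only [lastDiff, List.dropLast_cons_of_ne_nil hJ, colSum_cons, List.length_cons, pow_succ]
  ring

/-- Both compositions have the same total, and their lengths differ by one. With at least two
columns in `J`, the first column is not the last, so the sums without the last column agree as well.
-/
theorem lastDiff_cons_add_addHead (ε : (Fin ℓ → ℕ) → ℚ) (e : Col ℓ) {J : VComp ℓ}
    (hJ : 2 ≤ J.length) : lastDiff ε (e :: J) + lastDiff ε (addHead e J) = 0 := by
  match J with
  | a :: b :: J =>
    simp only [lastDiff, addHead, List.dropLast_cons_cons, colSum_cons, List.length_cons,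
      addCol, add_assoc]
    ring

theorem sum_lastDiff_singleton_of_isCoord (ε : (Fin ℓ → ℕ) → ℚ) {e : Col ℓ} (he : IsCoord e) :
    ∑ J ∈ refinements [e], lastDiff ε J = ε 0 - ε e.1 := by
  have h : refinements ([] : VComp ℓ) = {[]} := by
    ext J
    rw [mem_refinements, refines_nil_iff, Finset.mem_singleton]
  rw [sum_refinements_of_isCoord he, h, Finset.sum_singleton]
  simp [lastDiff, colSum_cons]

/-- Every pair cancels except the one from `[v]`, which gives `(ε(e + v) - ε(e)) - (ε(e + v) -
ε(0))`. -/
theorem sum_lastDiff_singleton (ε : (Fin ℓ → ℕ) → ℚ) {i e : Col ℓ} (h : SplitsOff i e) :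
    ∑ J ∈ refinements [i], lastDiff ε J = ε 0 - ε e.1 := by
  obtain ⟨c, he, v, hi, hc⟩ := splitsOff_iff.1 h
  rw [sum_refinements_of_first he hi hc, Finset.sum_eq_single [v]]
  · simp only [lastDiff, addHead, addCol, colSum_cons, colSum_nil, List.dropLast_cons_cons,
      List.dropLast_singleton, List.length_cons, List.length_nil, add_zero]
    ring
  · intro J hJ hne
    rw [mem_refinements] at hJ
    refine lastDiff_cons_add_addHead ε e ?_
    match J with
    | [] => simpa using hJ.length_le
    | [a] =>
      refine absurd ?_ hne
      have := hJ.colSum_eq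
      simp only [colSum_cons, colSum_nil, add_zero] at this
      rw [Subtype.ext this]
    | _ :: _ :: _ => simp
  · intro h
    exact absurd (mem_refinements.2 (Refines.refl _)) h

/-- Since `I` is nonempty, every refinement of `v :: I` has at least two columns, so all pairs
cancel. -/
theorem sum_lastDiff_cons_of_splitsOff (ε : (Fin ℓ → ℕ) → ℚ) {i e : Col ℓ} (h : SplitsOff i e)
    {I : VComp ℓ} (hI : I ≠ []) : ∑ J ∈ refinements (i :: I), lastDiff ε J = 0 := by
  obtain ⟨c, he, v, hi, hc⟩ := splitsOff_iff.1 h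
  rw [sum_refinements_of_first he hi hc]
  refine Finset.sum_eq_zero fun J hJ => lastDiff_cons_add_addHead ε e ?_
  have h1 := (mem_refinements.1 hJ).length_le
  have h2 := List.length_pos_iff.2 hI
  simp only [List.length_cons] at h1
  omega

theorem sum_lastDiff_cons_of_isCoord (ε : (Fin ℓ → ℕ) → ℚ) {e : Col ℓ} (he : IsCoord e)
    {I : VComp ℓ} (hI : I ≠ []) : ∑ J ∈ refinements (e :: I), lastDiff ε J =
      -∑ J ∈ refinements I, lastDiff (fun n => ε (e.1 + n)) J := by
  rw [sum_refinements_of_isCoord he, ← Finset.sum_neg_distrib]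
  refine Finset.sum_congr rfl fun J hJ => lastDiff_cons ε e ?_
  rintro rfl
  have h1 := (mem_refinements.1 hJ).length_le
  have h2 := List.length_pos_iff.2 hI
  simp only [List.length_nil] at h1
  omega

theorem isCoord_of_wt_le_one {i : Col ℓ} (h : wt i.1 ≤ 1) : IsCoord i := by
  obtain ⟨c, hc⟩ := Function.ne_iff.mp i.2
  have h1 := Finset.add_sum_erase Finset.univ i.1 (Finset.mem_univ c)
  change _ = wt i.1 at h1
  have h2 : i.1 c ≠ 0 := hc
  refine ⟨c, funext fun q => ?_⟩
  by_cases hq : q = c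
  · subst hq
    rw [Pi.single_eq_same]
    omega
  · rw [Pi.single_eq_of_ne hq]
    have h3 := Finset.sum_eq_zero_iff.1 (show ∑ x ∈ Finset.univ.erase c, i.1 x = 0 by omega)
    exact h3 q (by simp [hq])

theorem IsCoord.wt_eq_one {i : Col ℓ} (h : IsCoord i) : wt i.1 = 1 := by
  obtain ⟨c, hc⟩ := h
  rw [hc, wt_single]

/-- `e` is the first letter of the column `i`: the coordinate vector `i` itself, or the one that
splits off from it. -/
def IsFirstLetter (i e : Col ℓ) : Prop := (IsCoord i ∧ e = i) ∨ (1 < wt i.1 ∧ SplitsOff i e)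

theorem exists_isFirstLetter (i : Col ℓ) : ∃ e : Col ℓ, IsFirstLetter i e := by
  rcases le_or_gt (wt i.1) 1 with h | h
  · exact ⟨i, .inl ⟨isCoord_of_wt_le_one h, rfl⟩⟩
  · obtain ⟨e, he, -⟩ := existsUnique_splitsOff h
    exact ⟨e, .inr ⟨h, he⟩⟩

-- Induction on `E` for all `ε` at once. Each coordinate column contributes one sign and has weight
-- 1, so the signs collect to `(-1)^|E|`.
open Classical in
theorem sum_lastDiff_append_singleton {i e : Col ℓ} (he : IsFirstLetter i e) (E : VComp ℓ)
    (ε : (Fin ℓ → ℕ) → ℚ) :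
    ∑ J ∈ refinements (E ++ [i]), lastDiff ε J =
      if ∀ v ∈ E, IsCoord v then (-1) ^ weight E * (ε (colSum E) - ε (colSum E + e.1)) else 0 := by
  induction E generalizing ε with
  | nil =>
    rw [List.nil_append, if_pos (by simp)]
    simp only [weight, List.map_nil, List.sum_nil, pow_zero, one_mul, colSum_nil, zero_add]
    rcases he with ⟨hi, rfl⟩ | ⟨-, hi⟩
    · exact sum_lastDiff_singleton_of_isCoord ε hi
    · exact sum_lastDiff_singleton ε hi
  | cons a E ih =>
    rw [List.cons_append]
    rcases le_or_gt (wt a.1) 1 with h | h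
    · have ha := isCoord_of_wt_le_one h
      rw [sum_lastDiff_cons_of_isCoord ε ha (by simp), ih]
      simp only [List.forall_mem_cons, ha, true_and, colSum_cons, weight, List.map_cons,
        List.sum_cons, ha.wt_eq_one, add_assoc]
      split_ifs
      · rw [pow_add]; ring
      · exact neg_zero
    · obtain ⟨d, hd, -⟩ := existsUnique_splitsOff h
      rw [sum_lastDiff_cons_of_splitsOff ε hd (by simp), if_neg]
      intro hE
      have := (hE a (by simp)).wt_eq_one
      omega

theorem nuQ_F {I : VComp ℓ} (k : Fin ℓ → ℕ∞) (hI : I ≠ []) :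
    nuQ k (F I) = ∑ J ∈ refinements I, lastDiff (truncSign k) J := by
  rw [F, map_sum]
  refine Finset.sum_congr rfl fun J hJ => nuQ_M k ?_
  rintro rfl
  exact hI (by simpa using (mem_refinements.1 hJ).length_le)

theorem nuQ_F_nil (k : Fin ℓ → ℕ∞) : nuQ k (F ([] : VComp ℓ)) = 1 := by
  have h : (finite_refines ([] : VComp ℓ)).toFinset = {[]} := by
    ext J
    rw [Set.Finite.mem_toFinset, Set.mem_ofPred_eq, refines_nil_iff, Finset.mem_singleton]
  rw [F, h, Finset.sum_singleton, nuQ_M_nil]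

/-- The three cases for the last column amount to a condition on its first letter. -/
theorem ribbon_cases_iff (k : Fin ℓ → ℕ∞) (E : VComp ℓ) {i e : Col ℓ} (he : IsFirstLetter i e) :
    (LeExt (colSum (E ++ [i])) k ∨ (Odd (weight E) ∧ LeExt (colSum E) k) ∨
      (Even (weight E) ∧ 1 < wt i.1 ∧ ∃ e : Col ℓ, SplitsOff i e ∧ LeExt (colSum E + e.1) k)) ↔
    LeExt (colSum E + e.1) k ∨ (Odd (weight E) ∧ LeExt (colSum E) k) := by
  have hs : colSum (E ++ [i]) = colSum E + i.1 := by simp [colSum_append, colSum_cons]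
  rw [hs]
  rcases he with ⟨hi, rfl⟩ | ⟨hw, hi⟩
  -- For a coordinate vector `i`, case (3) is void and case (1) already concerns `e = i`.
  · simp [hi.wt_eq_one]
  · have huniq : ∀ e', SplitsOff i e' → e' = e := fun e' h' =>
      (existsUnique_splitsOff hw).unique h' hi
    obtain ⟨-, v, hv, -⟩ := id hi
    constructor
    · rintro (h | h | ⟨-, -, e', h', h⟩)
      · refine .inl (h.mono ?_)
        rw [hv, ← add_assoc]
        exact le_self_add
      · exact .inr h
      · exact .inl (huniq e' h' ▸ h)
    · rintro (h | h)
      -- The parity condition in case (3) loses nothing: for odd `|E|`, case (2) applies because `ΣE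
      -- ≤ ΣE + e`.
      · rcases Nat.even_or_odd (weight E) with hE | hE
        · exact .inr (.inr ⟨hE, hw, e, hi, h⟩)
        · exact .inr (.inl ⟨hE, h.mono le_self_add⟩)
      · exact .inr (.inl h)

-- If `ΣE + e ≤ k`, the two signs are opposite and the product is 2. If only `ΣE ≤ k`, it is `1 -
-- (-1)^|E|`. Otherwise both values of `ε` are 1.
open Classical in
theorem neg_one_pow_mul_truncSign_sub (k : Fin ℓ → ℕ∞) (E : VComp ℓ) {e : Fin ℓ → ℕ}
    (he : wt e = 1) :
    (-1) ^ weight E * (truncSign k (colSum E) - truncSign k (colSum E + e)) =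
      if LeExt (colSum E + e) k ∨ (Odd (weight E) ∧ LeExt (colSum E) k) then 2 else 0 := by
  have hmono : LeExt (colSum E + e) k → LeExt (colSum E) k := fun h => h.mono le_self_add
  rw [truncSign, truncSign, wt_add, he, ← weight_eq_wt_colSum, pow_succ]
  by_cases h1 : LeExt (colSum E + e) k <;> by_cases h2 : LeExt (colSum E) k <;>
    rcases Nat.even_or_odd (weight E) with hE | hE
  · simp [h1, h2, hE.neg_one_pow]; norm_num
  · simp [h1, h2, hE.neg_one_pow]; norm_num
  · exact absurd (hmono h1) h2
  · exact absurd (hmono h1) h2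
  · simp [h1, h2, hE.neg_one_pow, Nat.not_odd_iff_even.2 hE]
  · simp [h1, h2, hE.neg_one_pow, hE]; norm_num
  · simp [h1, h2]
  · simp [h1, h2]

theorem IsFirstLetter.wt_eq_one {i e : Col ℓ} (h : IsFirstLetter i e) : wt e.1 = 1 := by
  rcases h with ⟨h, rfl⟩ | ⟨-, h⟩
  · exact h.wt_eq_one
  · exact h.1.wt_eq_one

end LevelQSym

open LevelQSym Classical in
theorem theoremT (ℓ : ℕ) (k : Fin ℓ → ℕ∞) :
    -- the values on the monomial basis, at the empty and at the nonempty vector compositions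
    nuQ k (M ℓ []) = 1 ∧
    (∀ (I J : VComp ℓ) (i : Col ℓ), I = J ++ [i] →
      nuQ k (M ℓ I) =
        if Odd (wt i.1) ∧ LeExt (colSum I) k then
          2 * (-1) ^ (I.length + weight I)
        else if Odd (weight I - wt i.1) ∧ LeExt (colSum I - i.1) k ∧ ¬ LeExt (colSum I) k then
          2 * (-1) ^ I.length
        else 0) ∧
    -- the coordinate vector `e` in case (3) below exists and is unique
    (∀ i : Col ℓ, 1 < wt i.1 → ∃! e : Col ℓ, SplitsOff i e) ∧
    -- the values on the quasi-ribbon functions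
    nuQ k (F ([] : VComp ℓ)) = 1 ∧
    (∀ I : VComp ℓ, I ≠ [] →
      nuQ k (F I) =
        if ∃ (E : VComp ℓ) (i : Col ℓ), I = E ++ [i] ∧ (∀ v ∈ E, IsCoord v) ∧
            -- cases (1), (2) and (3)
            (LeExt (colSum I) k ∨
              (Odd (weight E) ∧ LeExt (colSum E) k) ∨
              (Even (weight E) ∧ 1 < wt i.1 ∧
                ∃ e : Col ℓ, SplitsOff i e ∧ LeExt (colSum E + e.1) k)) then 2
        else 0) := by
  refine ⟨nuQ_M_nil k, ?_, fun i => existsUnique_splitsOff, nuQ_F_nil k, fun I hI => ?_⟩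
  · rintro _ J i rfl
    exact nuQ_M_append_singleton k J i
  · obtain ⟨E, i, rfl⟩ : ∃ E i, I = E ++ [i] :=
      ⟨I.dropLast, I.getLast hI, (List.dropLast_append_getLast hI).symm⟩
    obtain ⟨e, he⟩ := exists_isFirstLetter i
    rw [nuQ_F k hI, sum_lastDiff_append_singleton he,
      neg_one_pow_mul_truncSign_sub k E he.wt_eq_one, ← ite_and]
    refine if_congr ?_ rfl rfl
    rw [← ribbon_cases_iff k E he]
    constructor
    · rintro ⟨h1, h2⟩
      exact ⟨E, i, rfl, h1, h2⟩
    -- The decomposition of `I` into an initial part and a last column is unique, so the existential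
    -- has one candidate.
    · rintro ⟨E', i', h, h1, h2⟩
      obtain ⟨rfl, h'⟩ := List.append_inj' h rfl
      obtain rfl := List.singleton_inj.1 h'
      exact ⟨h1, h2⟩
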